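/- Let $(\Omega,\mu)$ be a $\sigma$-finite measure space which contains no atoms of finite measure, that is, every measurable $T\subseteq\Omega$ with $0<\mu(T)<\infty$ contains a measurable $D\subseteq T$ with $0<\mu(D)<\mu(T)$. Let $1<p\le q<\infty$, and let $k\colon\Omega\times\Omega\to\mathbb R$ be measurable (with respect to the completed product measure) with $|k(t,s)|\le a(t)b(s)$ for almost all $(t,s)$, for some $a\in L_q(\Omega)$ and $b\in L_{p/(p-1)}(\Omega)$. Consider $$F(x)(t)=\int_\Omega k(t,s)\sin\bigl(x(t)-x(s)\bigr)\,ds .$$ (1) If $b$ is integrable (for instance if $\mu(\Omega)<\infty$), then $F$ acts from the real space $L_p(\Omega)$ into $L_q(\Omega)$, that is, for every $x\in L_p(\Omega)$ the integral exists for almost all $t\in\Omega$ and the function $F(x)$ belongs to $L_q(\Omega)$. (2) If $k\ne0$ (that is, $k$ does not vanish almost everywhere on $\Omega\times\Omega$) and $F$ acts from $L_p(\Omega)$ into $L_q(\Omega)$ in this sense, then the restriction of $F\colon L_p(\Omega)\to L_q(\Omega)$ to any nonempty open set $U\subseteq L_p(\Omega)$ fails to be compact: there is a bounded set $B\subseteq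 U$ such that $F(B)$ is not relatively compact in $L_q(\Omega)$. -/

import Mathlib

open MeasureTheory
open scoped ENNReal

/-- `Ω` contains no atom of finite measure: every measurable `T` with `0 < μ T < ∞` contains a
measurable `D` with `0 < μ D < μ T`. (This is not Mathlib's `NoAtoms`, which only says that
singletons are null sets.) -/
def NoFiniteAtoms {Ω : Type*} [MeasurableSpace Ω] (μ : Measure Ω) : Prop :=
  ∀ T : Set Ω, MeasurableSet T → 0 < μ T → μ T < ∞ →
    ∃ D : Set Ω, D ⊆ T ∧ MeasurableSet D ∧ 0 < μ D ∧ μ D < μ T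

/-- The function `t ↦ ∫ k(t,s) sin (x(t) - x(s)) ds`. -/
noncomputable def kuramotoIntegral {Ω : Type*} [MeasurableSpace Ω] (μ : Measure Ω)
    (k : Ω × Ω → ℝ) (x : Ω → ℝ) (t : Ω) : ℝ :=
  ∫ s, k (t, s) * Real.sin (x t - x s) ∂μ

/-- The integral formula really defines a map `L_p → L_q`: for every `x ∈ L_p`, the integral
exists for almost every `t`, and the resulting function of `t` belongs to `L_q`. -/
def KuramotoActs {Ω : Type*} [MeasurableSpace Ω] (μ : Measure Ω) (k : Ω × Ω → ℝ)
    (p q : ℝ≥0∞) : Prop :=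
  ∀ x : Lp ℝ p μ,
    (∀ᵐ t ∂μ, Integrable (fun s => k (t, s) * Real.sin (x t - x s)) μ) ∧
      MemLp (kuramotoIntegral μ k x) q μ

/-- The operator `F : L_p → L_q`, `F(x)(t) = ∫ k(t,s) sin (x(t) - x(s)) ds`. -/
noncomputable def kuramotoOperator {Ω : Type*} [MeasurableSpace Ω] {μ : Measure Ω}
    {k : Ω × Ω → ℝ} {p q : ℝ≥0∞} (hF : KuramotoActs μ k p q) (x : Lp ℝ p μ) : Lp ℝ q μ :=
  (hF x).2.toLp (kuramotoIntegral μ k x)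

/-- `F` maps bounded subsets of `U` to relatively compact sets. Continuity of `F` is not required,
so that the negation is as strong as possible. -/
def IsCompactMapOn {X Y : Type*} [PseudoMetricSpace X] [PseudoMetricSpace Y]
    (F : X → Y) (U : Set X) : Prop :=
  ∀ B : Set X, B ⊆ U → Bornology.IsBounded B → IsCompact (closure (F '' B))

/-! ### Splitting sets in the absence of atoms of finite measure. -/

section SmallSets

open Filter Topology Set

variable {Ω : Type*} [MeasurableSpace Ω] {μ : Measure Ω}

/-! Adding `π` on a set `A` flips the sign of `sin (x t - x s)` when exactly one of `t`, `s` lies in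
`A`. So `F (x + π 1_A)` is `±(F x - 2 ∫_A k sin)`, with the minus sign exactly on `A`
(`ae_add_pi_indicator`). If `F x ≠ 0`, take a small `D` on which `|F x| ≥ δ` and the correction is
negligible. Sets `A n ⊆ D` that pairwise differ on a third of `D` (`exists_seq_subset_symmDiff`)
then give perturbations of `x` inside `U` whose images are uniformly separated in `L_q`.

It remains to find `x ∈ U` with `F x ≠ 0` (`exists_operator_ne_zero`). If `F` vanished on `U`,
shifts by `π` and `π / 2` on a small `D` would make the integrals of `k sin` and `k cos` over `D`
vanish for almost every `t ∉ D`. Covering the space by tiny sets removes the restriction `t ∉ D`, so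
`k sin = k cos = 0` almost everywhere, and hence `k = 0`.

Part (1) is the domination of the integrand by `|a t| * |b s|`. -/

lemma NoFiniteAtoms.exists_pos_subset_le_half (hμ : NoFiniteAtoms μ) {T : Set Ω}
    (hT : MeasurableSet T) (h0 : 0 < μ T) (hfin : μ T < ∞) :
    ∃ D ⊆ T, MeasurableSet D ∧ 0 < μ D ∧ μ D ≤ μ T / 2 := by
  obtain ⟨D, hDT, hD, hD0, hDlt⟩ := hμ T hT h0 hfin
  have hadd : μ D + μ (T \ D) = μ T := by
    rw [← measure_union disjoint_sdiff_right (hT.diff hD), union_sdiff_cancel hDT]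
  by_cases h : μ D ≤ μ T / 2
  · exact ⟨D, hDT, hD, hD0, h⟩
  · refine ⟨T \ D, sdiff_subset, hT.diff hD, ?_, ?_⟩
    · rw [pos_iff_ne_zero]
      intro h0
      rw [h0, add_zero] at hadd
      exact hDlt.ne hadd
    · by_contra! h'
      push Not at h
      have := ENNReal.add_lt_add h h'
      rw [ENNReal.add_halves, hadd] at this
      exact lt_irrefl _ this

lemma NoFiniteAtoms.exists_pos_subset_le [SigmaFinite μ] (hμ : NoFiniteAtoms μ) {T : Set Ω}
    (hT : MeasurableSet T) (h0 : 0 < μ T) {ε : ℝ≥0∞} (hε : 0 < ε) :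
    ∃ D ⊆ T, MeasurableSet D ∧ 0 < μ D ∧ μ D ≤ ε := by
  obtain ⟨S, hS, hST, hS0, hSfin⟩ := Measure.exists_subset_measure_lt_top hT h0
  have key : ∀ n : ℕ, ∃ D ⊆ S, MeasurableSet D ∧ 0 < μ D ∧ μ D ≤ μ S * (2⁻¹ : ℝ≥0∞) ^ n := by
    intro n
    induction n with
    | zero => exact ⟨S, Subset.rfl, hS, hS0, by simp⟩
    | succ n ih =>
      obtain ⟨D, hDS, hD, hD0, hle⟩ := ih
      obtain ⟨D', hD'D, hD', hD'0, hle'⟩ := hμ.exists_pos_subset_le_half hD hD0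
        ((measure_mono hDS).trans_lt hSfin)
      refine ⟨D', hD'D.trans hDS, hD', hD'0, hle'.trans ?_⟩
      rw [pow_succ, ← mul_assoc, ENNReal.div_eq_inv_mul, mul_comm]
      gcongr
  have hlim : Tendsto (fun n : ℕ => μ S * (2⁻¹ : ℝ≥0∞) ^ n) atTop (𝓝 0) := by
    have := ENNReal.Tendsto.const_mul (a := μ S)
      (ENNReal.tendsto_pow_atTop_nhds_zero_of_lt_one (r := 2⁻¹) (by simp)) (Or.inr hSfin.ne)
    simpa using this
  obtain ⟨n, hn⟩ := (hlim.eventually (gt_mem_nhds hε)).exists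
  obtain ⟨D, hDS, hD, hD0, hle⟩ := key n
  exact ⟨D, hDS.trans hST, hD, hD0, hle.trans hn.le⟩

/-- A σ-finite measure without atoms of finite measure is carried by countably many sets of
arbitrarily small measure. -/
lemma NoFiniteAtoms.exists_cover [SigmaFinite μ] (hμ : NoFiniteAtoms μ) {ε : ℝ≥0∞} (hε : 0 < ε) :
    ∃ Q : ℕ → Set Ω, (∀ i, MeasurableSet (Q i)) ∧ (∀ i, μ (Q i) ≤ ε) ∧ μ (⋃ i, Q i)ᶜ = 0 := by
  -- Exhaustion: maximize the measure of such a union. `μ.toFinite` has the same null sets as `μ`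
  -- but is finite, so adding a non-null piece strictly increases it.
  let C : Set ℝ≥0∞ := {m | ∃ Q : ℕ → Set Ω, (∀ i, MeasurableSet (Q i)) ∧ (∀ i, μ (Q i) ≤ ε) ∧
    μ.toFinite (⋃ i, Q i) = m}
  have hC : C.Nonempty := ⟨_, fun _ => ∅, by simp, by simp, rfl⟩
  obtain ⟨u, -, hu, huC⟩ := exists_seq_tendsto_sSup hC (OrderTop.bddAbove C)
  choose Q hQm hQε hQu using huC
  let R : ℕ → Set Ω := fun n => Q n.unpair.1 n.unpair.2
  have hR : ∀ n i, Q n i ⊆ ⋃ j, R j := fun n i =>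
    subset_iUnion_of_subset (Nat.pair n i) (by simp [R])
  have hRm : MeasurableSet (⋃ j, R j) := .iUnion fun j => hQm _ _
  have hsup : μ.toFinite (⋃ j, R j) = sSup C := by
    refine le_antisymm (le_sSup ⟨R, fun j => hQm _ _, fun j => hQε _ _, rfl⟩) ?_
    refine le_of_tendsto' hu fun n => ?_
    rw [← hQu n]
    exact measure_mono (iUnion_subset (hR n))
  refine ⟨R, fun j => hQm _ _, fun j => hQε _ _, ?_⟩
  by_contra hne
  obtain ⟨D, hD, hDm, hD0, hDε⟩ := hμ.exists_pos_subset_le hRm.compl (pos_iff_ne_zero.2 hne) hε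
  have hD0' : μ.toFinite D ≠ 0 := fun h => hD0.ne' (absolutelyContinuous_toFinite μ h)
  have hmem : μ.toFinite ((⋃ j, R j) ∪ D) ∈ C := by
    refine ⟨fun n => Nat.casesOn n D R, fun i => ?_, fun i => ?_, ?_⟩
    · cases i
      exacts [hDm, hQm _ _]
    · cases i
      exacts [hDε, hQε _ _]
    · congr 1
      ext x
      simp only [mem_iUnion, mem_union]
      constructor
      · rintro ⟨_ | i, hi⟩
        exacts [Or.inr hi, Or.inl ⟨i, hi⟩]
      · rintro (⟨i, hi⟩ | h)
        exacts [⟨i + 1, hi⟩, ⟨0, h⟩]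
  have hle := le_sSup hmem
  rw [← hsup, measure_union (disjoint_compl_right.mono_right hD) hDm] at hle
  exact (ENNReal.lt_add_right (measure_ne_top _ _) hD0').not_ge hle

/-- Pieces of measure at most `μ T / 3` are added one by one until a third of `T` is reached; the
last piece cannot carry the total beyond two thirds. -/
lemma NoFiniteAtoms.exists_subset_third [SigmaFinite μ] (hμ : NoFiniteAtoms μ) {T : Set Ω}
    (hT : MeasurableSet T) (hfin : μ T < ∞) :
    ∃ A ⊆ T, MeasurableSet A ∧ μ.real T / 3 ≤ μ.real A ∧ μ.real T / 3 ≤ μ.real (T \ A) := by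
  rcases eq_or_ne (μ T) 0 with h0 | h0
  · exact ⟨∅, by simp, by simp, by simp [measureReal_def, h0], by simp [measureReal_def, h0]⟩
  have hpos : 0 < μ.real T := ENNReal.toReal_pos h0 hfin.ne
  obtain ⟨Q, hQm, hQε, hQ0⟩ := hμ.exists_cover (ε := ENNReal.ofReal (μ.real T / 3))
    (by simpa using hpos)
  let V : ℕ → Set Ω := fun n => T ∩ ⋃ i < n, Q i
  have hVm : ∀ n, MeasurableSet (V n) := fun n =>
    hT.inter (.iUnion fun i => .iUnion fun _ => hQm i)
  have hVfin : ∀ n, μ (V n) ≠ ∞ := fun n => ((measure_mono inter_subset_left).trans_lt hfin).ne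
  have hVmono : Monotone V := fun m n hmn => inter_subset_inter_right _
    (biUnion_subset_biUnion_left fun i (hi : i < m) => lt_of_lt_of_le hi hmn)
  have hVU : μ (⋃ n, V n) = μ T := by
    refine le_antisymm (measure_mono (iUnion_subset fun n => inter_subset_left)) ?_
    calc μ T ≤ μ ((⋃ n, V n) ∪ (⋃ i, Q i)ᶜ) := by
          refine measure_mono fun x hx => ?_
          by_cases h : x ∈ ⋃ i, Q i
          · obtain ⟨i, hi⟩ := mem_iUnion.1 h
            exact Or.inl (mem_iUnion.2 ⟨i + 1, hx, mem_biUnion (Nat.lt_succ_self i) hi⟩)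
          · exact Or.inr h
      _ ≤ _ := (measure_union_le _ _).trans (by rw [hQ0, add_zero])
  have hlim : Tendsto (fun n => μ.real (V n)) atTop (𝓝 (μ.real T)) := by
    have := tendsto_measure_iUnion_atTop (μ := μ) hVmono
    rw [hVU] at this
    exact (ENNReal.tendsto_toReal hfin.ne).comp this
  have hex : ∃ n, μ.real T / 3 ≤ μ.real (V n) :=
    ((hlim.eventually (lt_mem_nhds (by linarith : μ.real T / 3 < μ.real T))).exists).imp
      fun n hn => hn.le
  classical
  refine ⟨V (Nat.find hex), inter_subset_left, hVm _, Nat.find_spec hex, ?_⟩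
  rw [measureReal_sdiff inter_subset_left (hVm _) hfin.ne]
  -- `V 0` is empty, so the first successful stage has a predecessor.
  obtain ⟨m, hm⟩ : ∃ m, Nat.find hex = m + 1 := by
    refine Nat.exists_eq_succ_of_ne_zero fun h => ?_
    have := Nat.find_spec hex
    rw [h] at this
    simp [V] at this
    linarith
  have hlt : μ.real (V m) < μ.real T / 3 := by
    have := Nat.find_min hex (m := m) (by omega)
    simpa using this
  have hsub : V (m + 1) ⊆ V m ∪ Q m := by
    rintro x ⟨hxT, hx⟩
    obtain ⟨i, hi, hxi⟩ := mem_iUnion₂.1 hx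
    rcases (Nat.lt_succ_iff.1 hi).lt_or_eq with h | rfl
    exacts [Or.inl ⟨hxT, mem_biUnion h hxi⟩, Or.inr hxi]
  have hQfin : μ (Q m) ≠ ∞ := ((hQε m).trans_lt ENNReal.ofReal_lt_top).ne
  have hQr : μ.real (Q m) ≤ μ.real T / 3 :=
    ENNReal.toReal_le_of_le_ofReal (by positivity) (hQε m)
  have := (measureReal_mono hsub (measure_union_ne_top (hVfin m) hQfin)).trans
    (measureReal_union_le _ _)
  rw [hm]
  linarith

/-- In a space without atoms of finite measure, no finite family of sets is a net of mesh less
than `μ T / 3` in the measure algebra of `T`. -/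
lemma NoFiniteAtoms.exists_subset_symmDiff [SigmaFinite μ] (hμ : NoFiniteAtoms μ)
    (L : List (Set Ω)) (hL : ∀ B ∈ L, MeasurableSet B) {T : Set Ω}
    (hT : MeasurableSet T) (hfin : μ T < ∞) :
    ∃ A ⊆ T, MeasurableSet A ∧ μ.real T / 3 ≤ μ.real A ∧ μ.real T / 3 ≤ μ.real (T \ A) ∧
      ∀ B ∈ L, μ.real T / 3 ≤ μ.real (T ∩ symmDiff A B) := by
  induction L generalizing T with
  | nil =>
    obtain ⟨A, h1, h2, h3, h4⟩ := hμ.exists_subset_third hT hfin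
    exact ⟨A, h1, h2, h3, h4, by simp⟩
  | cons B L ih =>
    have hB : MeasurableSet B := hL B (by simp)
    have hL' : ∀ B ∈ L, MeasurableSet B := fun B hB => hL B (by simp [hB])
    have hf : ∀ S : Set Ω, S ⊆ T → μ S ≠ ∞ := fun S hS => ((measure_mono hS).trans_lt hfin).ne
    -- Solve the problem for the remaining sets separately inside and outside `B`; the union of the
    -- solutions works because all lower bounds add.
    obtain ⟨A₁, hA₁, hA₁m, h1, h2, h3⟩ := ih hL' (hT.inter hB)
      (hf _ inter_subset_left).lt_top
    obtain ⟨A₂, hA₂, hA₂m, h1', h2', h3'⟩ := ih hL' (hT.diff hB) (hf _ sdiff_subset).lt_top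
    have hsplit : ∀ S : Set Ω, S ⊆ T → μ.real (S ∩ B) + μ.real (S \ B) = μ.real S :=
      fun S hS => measureReal_inter_add_sdiff hB (hf S hS)
    have hTB := hsplit T Subset.rfl
    have hle : ∀ S S₁ S₂ : Set Ω, S ⊆ T → S₁ ⊆ S ∩ B → S₂ ⊆ S \ B →
        μ.real (T ∩ B) / 3 ≤ μ.real S₁ → μ.real (T \ B) / 3 ≤ μ.real S₂ →
        μ.real T / 3 ≤ μ.real S := by
      intro S S₁ S₂ hS hS₁ hS₂ ha hb
      have e := hsplit S hS
      have e1 := measureReal_mono hS₁ (hf _ (inter_subset_left.trans hS))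
      have e2 := measureReal_mono hS₂ (hf _ (sdiff_subset.trans hS))
      linarith
    have hA₁' : ∀ x ∈ A₁, x ∈ T ∧ x ∈ B := fun x hx => hA₁ hx
    have hA₂' : ∀ x ∈ A₂, x ∈ T ∧ x ∉ B := fun x hx => hA₂ hx
    refine ⟨A₁ ∪ A₂, ?_, hA₁m.union hA₂m, ?_, ?_, ?_⟩
    · exact union_subset (hA₁.trans inter_subset_left) (hA₂.trans sdiff_subset)
    · refine hle _ A₁ A₂ ?_ ?_ ?_ h1 h1' <;> intro x hx <;>
        have a₁ := hA₁' x <;> have a₂ := hA₂' x <;> clear hle hsplit hf h1 h2 h3 h1' h2' h3' <;>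
        simp only [mem_inter_iff, Set.mem_sdiff, mem_union] at * <;> tauto
    · refine hle _ _ _ ?_ ?_ ?_ h2 h2' <;> intro x hx <;>
        have a₁ := hA₁' x <;> have a₂ := hA₂' x <;> clear hle hsplit hf h1 h2 h3 h1' h2' h3' <;>
        simp only [mem_inter_iff, Set.mem_sdiff, mem_union] at * <;> tauto
    · intro B' hB'
      rcases List.mem_cons.1 hB' with rfl | hB'
      -- For the new set, the symmetric difference contains `(T ∩ B) \ A₁` and `A₂`. This is why the
      -- induction also carries a lower bound for the complement.
      · refine hle _ _ _ ?_ ?_ ?_ h2 h1' <;> intro x hx <;>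
          have a₁ := hA₁' x <;> have a₂ := hA₂' x <;> clear hle hsplit hf h1 h2 h3 h1' h2' h3' <;>
          simp only [mem_inter_iff, Set.mem_sdiff, mem_symmDiff, mem_union] at * <;> tauto
      · refine hle _ _ _ ?_ ?_ ?_ (h3 B' hB') (h3' B' hB') <;> intro x hx <;>
          have a₁ := hA₁' x <;> have a₂ := hA₂' x <;> clear hle hsplit hf h1 h2 h3 h1' h2' h3' <;>
          simp only [mem_inter_iff, Set.mem_sdiff, mem_symmDiff, mem_union] at * <;> tauto

end SmallSets

/-! ### Dominated kernels determined by integrals over small sets. -/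

section Kernels

open Filter Topology Set

variable {Ω : Type*} [MeasurableSpace Ω] {μ : Measure Ω}

lemma MeasureTheory.MemLp.integrableOn_of_measure_lt_top {f : Ω → ℝ} {r : ℝ≥0∞}
    (hf : MemLp f r μ) (hr : 1 ≤ r) {S : Set Ω} (hS : μ S < ∞) : IntegrableOn f S μ :=
  haveI := isFiniteMeasure_restrict.2 hS.ne
  (hf.restrict S).integrable hr

lemma ae_slice_bound [SFinite μ] {K : Ω × Ω → ℝ} (hK : AEStronglyMeasurable K (μ.prod μ))
    {a b : Ω → ℝ} (hab : ∀ᵐ z ∂(μ.prod μ), |K z| ≤ |a z.1| * |b z.2|) :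
    ∀ᵐ t ∂μ, AEStronglyMeasurable (fun s => K (t, s)) μ ∧ ∀ᵐ s ∂μ, |K (t, s)| ≤ |a t| * |b s| :=
  hK.prodMk_left.and (Measure.ae_ae_of_ae_prod hab)

lemma integrableOn_of_abs_le {f b : Ω → ℝ} {c : ℝ} (hf : AEStronglyMeasurable f μ)
    (h : ∀ᵐ s ∂μ, |f s| ≤ c * |b s|) {S : Set Ω} (hb : IntegrableOn b S μ) :
    IntegrableOn f S μ :=
  (hb.abs.const_mul c).mono' hf.restrict (ae_restrict_of_ae h)

lemma abs_setIntegral_le_of_abs_le {f b : Ω → ℝ} {c : ℝ}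
    (h : ∀ᵐ s ∂μ, |f s| ≤ c * |b s|) {S : Set Ω} (hb : IntegrableOn b S μ) :
    |∫ s in S, f s ∂μ| ≤ c * ∫ s in S, |b s| ∂μ := by
  rw [← integral_const_mul]
  have h' : ∀ᵐ s ∂μ, ‖f s‖ ≤ c * |b s| := h
  exact norm_integral_le_of_norm_le (hb.abs.const_mul c) (ae_restrict_of_ae h')

lemma exists_pos_setIntegral_abs_le {b : Ω → ℝ} {S : Set Ω} (hb : IntegrableOn b S μ) {η : ℝ}
    (hη : 0 < η) :
    ∃ δ : ℝ≥0∞, 0 < δ ∧ ∀ D, MeasurableSet D → μ D ≤ δ → ∫ s in S ∩ D, |b s| ∂μ ≤ η := by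
  obtain ⟨δ, hδ, h⟩ := exists_pos_setLIntegral_lt_of_measure_lt (μ := μ.restrict S)
    (f := fun s => ‖b s‖ₑ) hb.2.ne (ε := ENNReal.ofReal η) (by simpa using hη)
  obtain ⟨δ', hδ', hlt⟩ := exists_between hδ
  refine ⟨δ', hδ', fun D hD hle => ?_⟩
  have h1 := h D (((Measure.restrict_apply_le S D).trans hle).trans_lt hlt)
  rw [Measure.restrict_restrict hD, inter_comm] at h1
  have : ∫ s in S ∩ D, |b s| ∂μ = (∫⁻ s in S ∩ D, ‖b s‖ₑ ∂μ).toReal :=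
    integral_norm_eq_lintegral_enorm (hb.1.mono_measure (Measure.restrict_mono_set μ
      inter_subset_left))
  rw [this]
  exact ENNReal.toReal_le_of_le_ofReal hη.le h1.le

/-- If the integrals of a dominated kernel over small sets vanish off these sets, then they vanish
everywhere: without atoms of finite measure the diagonal does not matter. -/
lemma NoFiniteAtoms.ae_setIntegral_eq_zero [SigmaFinite μ] (hμ : NoFiniteAtoms μ)
    {K : Ω × Ω → ℝ} (hK : AEStronglyMeasurable K (μ.prod μ)) {a b : Ω → ℝ}
    (hab : ∀ᵐ z ∂(μ.prod μ), |K z| ≤ |a z.1| * |b z.2|)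
    (hb : ∀ S, μ S < ∞ → IntegrableOn b S μ) {δ : ℝ≥0∞} (hδ : δ < ∞)
    (h : ∀ D, MeasurableSet D → μ D ≤ δ → ∀ᵐ t ∂μ, t ∉ D → ∫ s in D, K (t, s) ∂μ = 0)
    {S : Set Ω} (hS : MeasurableSet S) (hSδ : μ S ≤ δ) :
    ∀ᵐ t ∂μ, ∫ s in S, K (t, s) ∂μ = 0 := by
  have hbS := hb S (hSδ.trans_lt hδ)
  have key : ∀ n : ℕ, ∀ᵐ t ∂μ, |∫ s in S, K (t, s) ∂μ| ≤ |a t| * (1 / ((n : ℝ) + 1)) := by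
    intro n
    obtain ⟨ε, hε, hbε⟩ := exists_pos_setIntegral_abs_le hbS (η := 1 / ((n : ℝ) + 1))
      (by positivity)
    obtain ⟨Q, hQm, hQε, hQ⟩ := hμ.exists_cover hε
    -- For `t ∈ Q i` the set `S \ Q i` avoids `t`, so only `S ∩ Q i` contributes, and there the
    -- integral of `|b|` is tiny.
    have hzero : ∀ᵐ t ∂μ, ∀ i, t ∉ S \ Q i → ∫ s in S \ Q i, K (t, s) ∂μ = 0 :=
      ae_all_iff.2 fun i => h _ (hS.diff (hQm i)) ((measure_mono sdiff_subset).trans hSδ)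
    have hcov : ∀ᵐ t ∂μ, t ∈ ⋃ i, Q i := hQ
    filter_upwards [hzero, hcov, ae_slice_bound hK hab] with t h0 ht ⟨hm, hle⟩
    obtain ⟨i, hi⟩ := mem_iUnion.1 ht
    have hsplit := integral_inter_add_sdiff (hQm i) (integrableOn_of_abs_le hm hle hbS)
    rw [h0 i (fun h => h.2 hi), add_zero] at hsplit
    rw [← hsplit]
    refine (abs_setIntegral_le_of_abs_le hle (hbS.mono_set inter_subset_left)).trans ?_
    exact mul_le_mul_of_nonneg_left (hbε _ (hQm i) (hQε i)) (abs_nonneg _)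
  filter_upwards [ae_all_iff.2 key] with t ht
  have hlim : Tendsto (fun n : ℕ => |a t| * (1 / ((n : ℝ) + 1))) atTop (𝓝 (|a t| * 0)) :=
    tendsto_one_div_add_atTop_nhds_zero_nat.const_mul _
  rw [mul_zero] at hlim
  exact abs_nonpos_iff.1 (ge_of_tendsto' hlim ht)

/-- Rectangles form a generating π-system. Since the total integral is zero, the sets of zero
integral are closed under complements as well as countable disjoint unions. -/
lemma MeasureTheory.Integrable.ae_eq_zero_of_forall_setIntegral_prod_eq_zero {Ω' : Type*}
    [MeasurableSpace Ω'] {ν : Measure Ω'}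
    [SFinite μ] [SFinite ν] {K : Ω × Ω' → ℝ} (hK : Integrable K (μ.prod ν))
    (h : ∀ A B, MeasurableSet A → MeasurableSet B → ∫ z in A ×ˢ B, K z ∂(μ.prod ν) = 0) :
    K =ᵐ[μ.prod ν] 0 := by
  suffices H : ∀ R, MeasurableSet R → ∫ z in R, K z ∂(μ.prod ν) = 0 from
    hK.ae_eq_zero_of_forall_setIntegral_eq_zero fun R hR _ => H R hR
  intro R hR
  induction R, hR using MeasurableSpace.induction_on_inter generateFrom_prod.symm
    isPiSystem_prod with
  | empty => simp
  | basic R hR =>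
    obtain ⟨A, hA, B, hB, rfl⟩ := hR
    exact h A B hA hB
  | compl R hR ih =>
    have h1 := integral_add_compl hR hK
    have h2 := h univ univ .univ .univ
    rw [univ_prod_univ, Measure.restrict_univ] at h2
    rwa [ih, h2, zero_add] at h1
  | iUnion R hd hR ih =>
    rw [integral_iUnion hR hd hK.integrableOn]
    simp [ih]

/-- A dominated kernel is determined by its integrals over small sets. -/
lemma NoFiniteAtoms.kernel_ae_eq_zero [SigmaFinite μ] (hμ : NoFiniteAtoms μ)
    {K : Ω × Ω → ℝ} (hK : AEStronglyMeasurable K (μ.prod μ)) {a b : Ω → ℝ}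
    (hab : ∀ᵐ z ∂(μ.prod μ), |K z| ≤ |a z.1| * |b z.2|)
    (ha : ∀ S, μ S < ∞ → IntegrableOn a S μ)
    (hb : ∀ S, μ S < ∞ → IntegrableOn b S μ) {δ : ℝ≥0∞} (hδ0 : 0 < δ) (hδ : δ < ∞)
    (h : ∀ S, MeasurableSet S → μ S ≤ δ → ∀ᵐ t ∂μ, ∫ s in S, K (t, s) ∂μ = 0) :
    K =ᵐ[μ.prod μ] 0 := by
  obtain ⟨Q, hQm, hQδ, hQ⟩ := hμ.exists_cover hδ0
  have hrect : ∀ i j, ∀ᵐ z ∂(μ.prod μ).restrict (Q i ×ˢ Q j), K z = 0 := by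
    intro i j
    rw [← Measure.prod_restrict]
    have hint : Integrable K ((μ.restrict (Q i)).prod (μ.restrict (Q j))) := by
      refine ((ha _ ((hQδ i).trans_lt hδ)).abs.mul_prod (hb _ ((hQδ j).trans_lt hδ)).abs).mono' ?_ ?_
      · rw [Measure.prod_restrict]
        exact hK.restrict
      · rw [Measure.prod_restrict]
        exact ae_restrict_of_ae hab
    refine hint.ae_eq_zero_of_forall_setIntegral_prod_eq_zero fun A B hA hB => ?_
    rw [setIntegral_prod _ hint.integrableOn, Measure.restrict_restrict hA,
      Measure.restrict_restrict hB]
    refine integral_eq_zero_of_ae (ae_restrict_of_ae ?_)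
    exact h _ (hB.inter (hQm j)) ((measure_mono inter_subset_right).trans (hQδ j))
  have hcov : ∀ᵐ t ∂μ, t ∈ ⋃ i, Q i := hQ
  have h1 : ∀ᵐ z ∂(μ.prod μ), z.1 ∈ ⋃ i, Q i := Measure.quasiMeasurePreserving_fst.ae hcov
  have h2 : ∀ᵐ z ∂(μ.prod μ), z.2 ∈ ⋃ i, Q i := Measure.quasiMeasurePreserving_snd.ae hcov
  have h3 : ∀ᵐ z ∂(μ.prod μ), ∀ i j, z ∈ Q i ×ˢ Q j → K z = 0 :=
    ae_all_iff.2 fun i => ae_all_iff.2 fun j =>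
      (ae_restrict_iff' ((hQm i).prod (hQm j))).1 (hrect i j)
  filter_upwards [h1, h2, h3] with z hz1 hz2 hz
  obtain ⟨i, hi⟩ := mem_iUnion.1 hz1
  obtain ⟨j, hj⟩ := mem_iUnion.1 hz2
  exact hz i j ⟨hi, hj⟩

end Kernels

/-! ### Effect of shifting `x` by a constant on a set. -/

section Perturbation

open Filter Topology Set

variable {Ω : Type*} [MeasurableSpace Ω] {μ : Measure Ω} {k : Ω × Ω → ℝ} {p q : ℝ≥0∞}

lemma exists_pos_norm_indicatorConstLp_lt (hp0 : p ≠ 0) (hp : p ≠ ∞) {ε : ℝ}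
    (hε : 0 < ε) (C : ℝ) : ∃ δ : ℝ≥0∞, 0 < δ ∧ δ < ∞ ∧
      ∀ (D : Set Ω) (hD : MeasurableSet D) (hfin : μ D ≠ ∞) (c : ℝ), |c| ≤ C → μ D ≤ δ →
        ‖indicatorConstLp p hD hfin c‖ < ε := by
  have hp' : 0 < p.toReal := ENNReal.toReal_pos hp0 hp
  have hC : 0 < |C| + 1 := by positivity
  have hη : 0 < ε / (2 * (|C| + 1)) := by positivity
  refine ⟨ENNReal.ofReal ((ε / (2 * (|C| + 1))) ^ p.toReal), ?_, ENNReal.ofReal_lt_top, ?_⟩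
  · rw [ENNReal.ofReal_pos]
    positivity
  · intro D hD hfin c hc hle
    have h1 : μ.real D ≤ (ε / (2 * (|C| + 1))) ^ p.toReal :=
      ENNReal.toReal_le_of_le_ofReal (by positivity) hle
    have h2 : μ.real D ^ (1 / p.toReal) ≤ ε / (2 * (|C| + 1)) := by
      refine (Real.rpow_le_rpow measureReal_nonneg h1 (by positivity)).trans_eq ?_
      rw [one_div, Real.rpow_rpow_inv hη.le hp'.ne']
    rw [norm_indicatorConstLp hp0 hp]
    have h3 : ‖c‖ ≤ |C| + 1 := by
      rw [Real.norm_eq_abs]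
      linarith [le_abs_self C]
    calc ‖c‖ * μ.real D ^ (1 / p.toReal) ≤ (|C| + 1) * (ε / (2 * (|C| + 1))) := by gcongr
      _ = ε / 2 := by field_simp
      _ < ε := half_lt_self hε

/-- Allows pointwise computation with an explicit representative, such as a sum with an indicator.
-/
lemma KuramotoActs.ae_of_ae_eq (hF : KuramotoActs μ k p q) (z : Lp ℝ p μ) {y : Ω → ℝ}
    (hy : z =ᵐ[μ] y) :
    ∀ᵐ t ∂μ, Integrable (fun s => k (t, s) * Real.sin (y t - y s)) μ ∧
      kuramotoOperator hF z t = ∫ s, k (t, s) * Real.sin (y t - y s) ∂μ := by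
  filter_upwards [hy, (hF z).1, (hF z).2.coeFn_toLp] with t ht hint hop
  have hcongr : (fun s => k (t, s) * Real.sin (z t - z s)) =ᵐ[μ]
      fun s => k (t, s) * Real.sin (y t - y s) := by
    filter_upwards [hy] with s hs
    rw [ht, hs]
  exact ⟨hint.congr hcongr, hop.trans (integral_congr_ae hcongr)⟩

lemma KuramotoActs.ae_add_indicator (hF : KuramotoActs μ k p q) (x : Lp ℝ p μ)
    {D : Set Ω} (hD : MeasurableSet D) (hfin : μ D ≠ ∞) (c : ℝ) :
    ∀ᵐ t ∂μ,
      Integrable (fun s => k (t, s) * Real.sin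
        (x t + D.indicator (fun _ => c) t - (x s + D.indicator (fun _ => c) s))) μ ∧
      kuramotoOperator hF (x + indicatorConstLp p hD hfin c) t =
        ∫ s, k (t, s) * Real.sin
          (x t + D.indicator (fun _ => c) t - (x s + D.indicator (fun _ => c) s)) ∂μ :=
  hF.ae_of_ae_eq (y := fun t => x t + D.indicator (fun _ => c) t) _
    ((Lp.coeFn_add _ _).trans (EventuallyEq.rfl.add indicatorConstLp_coeFn))

/-- Adding `π` on a set `A` changes the sign of `sin (x t - x s)` whenever exactly one of `t`, `s`
belongs to `A`. -/
lemma KuramotoActs.ae_add_pi_indicator (hF : KuramotoActs μ k p q) (x : Lp ℝ p μ)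
    {A : Set Ω} (hA : MeasurableSet A) (hfin : μ A ≠ ∞) :
    ∀ᵐ t ∂μ, kuramotoOperator hF (x + indicatorConstLp p hA hfin Real.pi) t =
      (1 - 2 * A.indicator 1 t) * (kuramotoOperator hF x t -
        2 * ∫ s in A, k (t, s) * Real.sin (x t - x s) ∂μ) := by
  filter_upwards [hF.ae_add_indicator x hA hfin Real.pi, hF.ae_of_ae_eq x EventuallyEq.rfl]
    with t ⟨_, hop⟩ ⟨hint, hop0⟩
  rw [hop, hop0, ← integral_indicator hA, ← integral_const_mul, ← integral_sub hint
    ((hint.indicator hA).const_mul 2), ← integral_const_mul]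
  congr 1 with s
  by_cases ht : t ∈ A <;> by_cases hs : s ∈ A <;> simp only [ht, hs, indicator_of_mem,
    indicator_of_notMem, not_false_eq_true, Pi.one_apply, add_zero]
  · rw [add_sub_add_right_eq_sub]
    ring
  · rw [add_sub_right_comm, Real.sin_add_pi]
    ring
  · rw [← sub_sub, Real.sin_sub_pi]
    ring
  · ring

/-- If the operator vanishes on a neighbourhood of `x`, the integrals of `k(t,s) sin (x(t) - x(s))`
and `k(t,s) cos (x(t) - x(s))` over small sets vanish off these sets. -/
lemma KuramotoActs.ae_setIntegral_eq_zero_of_notMem (hF : KuramotoActs μ k p q) (x : Lp ℝ p μ)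
    {D : Set Ω} (hD : MeasurableSet D) (hfin : μ D ≠ ∞) (h0 : kuramotoOperator hF x = 0)
    (h1 : kuramotoOperator hF (x + indicatorConstLp p hD hfin Real.pi) = 0)
    (h2 : kuramotoOperator hF (x + indicatorConstLp p hD hfin (Real.pi / 2)) = 0) :
    ∀ᵐ t ∂μ, t ∉ D → ∫ s in D, k (t, s) * Real.sin (x t - x s) ∂μ = 0 ∧
      ∫ s in D, k (t, s) * Real.cos (x t - x s) ∂μ = 0 := by
  have hz : ∀ z : Lp ℝ q μ, z = 0 → ∀ᵐ t ∂μ, z t = 0 := by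
    rintro _ rfl
    exact Lp.coeFn_zero _ _ _
  filter_upwards [hF.ae_add_pi_indicator x hD hfin, hF.ae_add_indicator x hD hfin (Real.pi / 2),
    hF.ae_of_ae_eq x EventuallyEq.rfl, hz _ h0, hz _ h1, hz _ h2]
    with t e1 ⟨hint2, e2⟩ ⟨hint0, e0⟩ z0 z1 z2 ht
  have hsin : ∫ s in D, k (t, s) * Real.sin (x t - x s) ∂μ = 0 := by
    rw [z1, z0, indicator_of_notMem ht] at e1
    linarith
  refine ⟨hsin, ?_⟩
  rw [z2] at e2
  rw [z0] at e0
  -- Since `t ∉ D`, the shift by `π / 2` turns `sin` into `-cos` for `s ∈ D` and changes nothing for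
  -- other `s`.
  have hdiff : (fun s => k (t, s) * Real.sin (x t - x s) - k (t, s) * Real.sin (x t +
      D.indicator (fun _ => Real.pi / 2) t - (x s + D.indicator (fun _ => Real.pi / 2) s))) =
      D.indicator fun s => k (t, s) * Real.sin (x t - x s) + k (t, s) * Real.cos (x t - x s) := by
    ext s
    by_cases hs : s ∈ D <;> simp only [ht, hs, indicator_of_mem, indicator_of_notMem,
      not_false_eq_true, add_zero]
    · rw [← sub_sub, Real.sin_sub_pi_div_two]
      ring
    · ring
  have hsum := integral_sub hint0 hint2
  rw [← e0, ← e2, sub_zero, hdiff, integral_indicator hD] at hsum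
  have hintD := (hint0.sub hint2)
  have hintD' : Integrable (D.indicator fun s =>
      k (t, s) * Real.sin (x t - x s) + k (t, s) * Real.cos (x t - x s)) μ := by
    rw [← hdiff]
    exact hintD
  rw [integrable_indicator_iff hD] at hintD'
  have hcos : IntegrableOn (fun s => k (t, s) * Real.cos (x t - x s)) D μ :=
    (hintD'.sub hint0.integrableOn).congr (ae_of_all _ fun s => by simp)
  rwa [integral_add hint0.integrableOn hcos, hsin, zero_add] at hsum

end Perturbation

/-! ### Acting, nonvanishing and separated images. -/

section Noncompactness

open Filter Topology Set

variable {Ω : Type*} [MeasurableSpace Ω] {μ : Measure Ω} {k : Ω × Ω → ℝ} {p q : ℝ≥0∞}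
  {a b : Ω → ℝ}

lemma kuramotoActs_of_integrable [SigmaFinite μ] (hk : AEStronglyMeasurable k (μ.prod μ))
    (ha : MemLp a q μ) (hb : Integrable b μ)
    (hab : ∀ᵐ z ∂(μ.prod μ), |k z| ≤ |a z.1| * |b z.2|) : KuramotoActs μ k p q := by
  intro x
  have hx : AEStronglyMeasurable (fun z : Ω × Ω => x z.1 - x z.2) (μ.prod μ) :=
    (Lp.aestronglyMeasurable x).comp_fst.sub (Lp.aestronglyMeasurable x).comp_snd
  have hm : AEStronglyMeasurable (fun z : Ω × Ω => k z * Real.sin (x z.1 - x z.2)) (μ.prod μ) :=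
    hk.mul (Real.continuous_sin.comp_aestronglyMeasurable hx)
  have hle : ∀ᵐ z ∂(μ.prod μ), |k z * Real.sin (x z.1 - x z.2)| ≤ |a z.1| * |b z.2| := by
    filter_upwards [hab] with z hz
    rw [abs_mul]
    exact (mul_le_of_le_one_right (abs_nonneg _) (Real.abs_sin_le_one _)).trans hz
  have hsl := ae_slice_bound hm hle
  refine ⟨?_, ?_⟩
  · filter_upwards [hsl] with t ⟨h1, h2⟩
    exact (hb.abs.const_mul _).mono' h1 h2
  · refine (ha.abs.mul_const (∫ s, |b s| ∂μ)).mono' hm.integral_prod_right' ?_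
    filter_upwards [hsl] with t ⟨h1, h2⟩
    have := abs_setIntegral_le_of_abs_le (S := univ) h2 hb.integrableOn
    rwa [Measure.restrict_univ] at this

/-- Vanishing on a ball would give vanishing integrals of both `k sin` and `k cos` over all small
sets; as `sin` and `cos` have no common zero, `k` would be null. -/
lemma KuramotoActs.exists_operator_ne_zero [SigmaFinite μ] [Fact (1 ≤ p)] (hF : KuramotoActs μ k p q)
    (hμ : NoFiniteAtoms μ) (hp : p ≠ ∞) (hk : AEStronglyMeasurable k (μ.prod μ))
    (ha : ∀ S, μ S < ∞ → IntegrableOn a S μ) (hb : ∀ S, μ S < ∞ → IntegrableOn b S μ)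
    (hab : ∀ᵐ z ∂(μ.prod μ), |k z| ≤ |a z.1| * |b z.2|) (hk0 : ¬ k =ᵐ[μ.prod μ] 0)
    {U : Set (Lp ℝ p μ)} (hU : IsOpen U) (hne : U.Nonempty) :
    ∃ x ∈ U, kuramotoOperator hF x ≠ 0 := by
  by_contra! hzero
  obtain ⟨x, hx⟩ := hne
  obtain ⟨ε, hε, hball⟩ := Metric.isOpen_iff.1 hU x hx
  obtain ⟨δ, hδ0, hδ, hnorm⟩ := exists_pos_norm_indicatorConstLp_lt (μ := μ) (p := p)
    (zero_lt_one.trans_le Fact.out).ne' hp hε Real.pi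
  have hmem : ∀ (D : Set Ω) (hD : MeasurableSet D) (hfin : μ D ≠ ∞) (c : ℝ), |c| ≤ Real.pi →
      μ D ≤ δ → kuramotoOperator hF (x + indicatorConstLp p hD hfin c) = 0 := by
    intro D hD hfin c hc hle
    refine hzero _ (hball ?_)
    rw [mem_ball_iff_norm, add_sub_cancel_left]
    exact hnorm D hD hfin c hc hle
  have hpi := Real.pi_pos
  have hD : ∀ D, MeasurableSet D → μ D ≤ δ → ∀ᵐ t ∂μ, t ∉ D →
      ∫ s in D, k (t, s) * Real.sin (x t - x s) ∂μ = 0 ∧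
      ∫ s in D, k (t, s) * Real.cos (x t - x s) ∂μ = 0 := by
    intro D hDm hle
    have hfin := (hle.trans_lt hδ).ne
    exact hF.ae_setIntegral_eq_zero_of_notMem x hDm hfin (hzero x hx)
      (hmem D hDm hfin _ (abs_of_pos hpi).le hle)
      (hmem D hDm hfin _ (by rw [abs_of_pos (by linarith)]; linarith) hle)
  have hxm : AEStronglyMeasurable (fun z : Ω × Ω => x z.1 - x z.2) (μ.prod μ) :=
    (Lp.aestronglyMeasurable x).comp_fst.sub (Lp.aestronglyMeasurable x).comp_snd
  have hmul : ∀ φ : ℝ → ℝ, Continuous φ → (∀ r, |φ r| ≤ 1) →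
      (∀ D, MeasurableSet D → μ D ≤ δ → ∀ᵐ t ∂μ, t ∉ D →
        ∫ s in D, k (t, s) * φ (x t - x s) ∂μ = 0) →
      (fun z : Ω × Ω => k z * φ (x z.1 - x z.2)) =ᵐ[μ.prod μ] 0 := by
    intro φ hφ hφ1 hφ0
    have hm : AEStronglyMeasurable (fun z : Ω × Ω => k z * φ (x z.1 - x z.2)) (μ.prod μ) :=
      hk.mul (hφ.comp_aestronglyMeasurable hxm)
    have hle : ∀ᵐ z ∂(μ.prod μ), |k z * φ (x z.1 - x z.2)| ≤ |a z.1| * |b z.2| := by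
      filter_upwards [hab] with z hz
      rw [abs_mul]
      exact (mul_le_of_le_one_right (abs_nonneg _) (hφ1 _)).trans hz
    exact hμ.kernel_ae_eq_zero hm hle ha hb hδ0 hδ fun S hS hSδ =>
      hμ.ae_setIntegral_eq_zero hm hle hb hδ hφ0 hS hSδ
  refine hk0 ?_
  filter_upwards [hmul Real.sin Real.continuous_sin Real.abs_sin_le_one
      fun D h1 h2 => (hD D h1 h2).mono fun t ht h => (ht h).1,
    hmul Real.cos Real.continuous_cos Real.abs_cos_le_one
      fun D h1 h2 => (hD D h1 h2).mono fun t ht h => (ht h).2] with z hs hc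
  simp only [Pi.zero_apply, mul_eq_zero] at hs hc ⊢
  rcases hs with h | hs
  · exact h
  rcases hc with h | hc
  · exact h
  have := Real.sin_sq_add_cos_sq (x z.1 - x z.2)
  rw [hs, hc] at this
  norm_num at this

lemma not_isCompact_closure_of_pairwise_le_dist {X : Type*} [PseudoMetricSpace X] {S : Set X}
    {u : ℕ → X} (hu : ∀ n, u n ∈ S) {c : ℝ} (hc : 0 < c)
    (h : Pairwise fun m n => c ≤ dist (u m) (u n)) : ¬ IsCompact (closure S) := by
  intro hcomp
  obtain ⟨_, -, φ, hφ, hlim⟩ := hcomp.tendsto_subseq fun n => subset_closure (hu n)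
  obtain ⟨N, hN⟩ := Metric.cauchySeq_iff.1 hlim.cauchySeq c hc
  exact (hN N le_rfl (N + 1) N.le_succ).not_ge (h (hφ N.lt_succ_self).ne)

/-- Greedy choice: each new set stays far from the finitely many already chosen. -/
lemma NoFiniteAtoms.exists_seq_subset_symmDiff [SigmaFinite μ] (hμ : NoFiniteAtoms μ) {T : Set Ω}
    (hT : MeasurableSet T) (hfin : μ T < ∞) :
    ∃ A : ℕ → Set Ω, (∀ n, A n ⊆ T ∧ MeasurableSet (A n)) ∧
      Pairwise fun m n => μ.real T / 3 ≤ μ.real (T ∩ symmDiff (A m) (A n)) := by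
  let r : Set Ω → Set Ω → Prop := fun A B => μ.real T / 3 ≤ μ.real (T ∩ symmDiff A B)
  have : Std.Symm r := ⟨fun A B h => by simpa only [r, symmDiff_comm B A] using h⟩
  refine exists_seq_of_forall_finset_exists' (fun A => A ⊆ T ∧ MeasurableSet A) r fun s hs => ?_
  obtain ⟨A, hA, hAm, -, -, h⟩ := hμ.exists_subset_symmDiff s.toList
    (fun B hB => (hs B (Finset.mem_toList.1 hB)).2) hT hfin
  exact ⟨A, ⟨hA, hAm⟩, fun B hB => symm_of r (h B (Finset.mem_toList.2 hB))⟩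

/-- A nonzero function is bounded below, and a given function is bounded above, on some set of
positive measure. -/
lemma exists_measurableSet_pos_le_abs {f a : Ω → ℝ} (hf : StronglyMeasurable f)
    (ha : StronglyMeasurable a) (h : ¬ f =ᵐ[μ] 0) :
    ∃ δ > 0, ∃ M ≥ 0, ∃ E, MeasurableSet E ∧ 0 < μ E ∧ ∀ t ∈ E, δ ≤ |f t| ∧ |a t| ≤ M := by
  let E : ℕ → Set Ω := fun n => {t | 1 / ((n : ℝ) + 1) ≤ |f t| ∧ |a t| ≤ n}
  have hE : ∀ n, MeasurableSet (E n) := fun n =>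
    (measurableSet_le measurable_const hf.measurable.abs).inter
      (measurableSet_le ha.measurable.abs measurable_const)
  have hU : μ (⋃ n, E n) ≠ 0 := by
    intro h0
    refine h (measure_mono_null (fun t ht => ?_) h0)
    have ht : f t ≠ 0 := ht
    obtain ⟨n, hn⟩ := exists_nat_one_div_lt (abs_pos.2 ht)
    obtain ⟨m, hm⟩ := exists_nat_ge |a t|
    refine mem_iUnion.2 ⟨max n m, (one_div_le_one_div_of_le (by positivity) ?_).trans hn.le,
      hm.trans (by exact_mod_cast le_max_right n m)⟩
    gcongr
    exact_mod_cast le_max_left n m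
  obtain ⟨n, hn⟩ := exists_measure_pos_of_not_measure_iUnion_null hU
  exact ⟨1 / ((n : ℝ) + 1), by positivity, n, by positivity, E n, hE n, hn, fun t ht => ht⟩

lemma KuramotoActs.not_isCompactMapOn [SigmaFinite μ] [Fact (1 ≤ p)] [Fact (1 ≤ q)]
    (hF : KuramotoActs μ k p q)
    (hμ : NoFiniteAtoms μ) (hp : p ≠ ∞) (hq : q ≠ ∞) (hk : AEStronglyMeasurable k (μ.prod μ))
    (ha : AEStronglyMeasurable a μ) (hb : ∀ S, μ S < ∞ → IntegrableOn b S μ)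
    (hab : ∀ᵐ z ∂(μ.prod μ), |k z| ≤ |a z.1| * |b z.2|)
    {U : Set (Lp ℝ p μ)} (hU : IsOpen U) {x : Lp ℝ p μ} (hx : x ∈ U)
    (hne : kuramotoOperator hF x ≠ 0) : ¬ IsCompactMapOn (kuramotoOperator hF) U := by
  intro hcomp
  set G := kuramotoOperator hF x with hG
  obtain ⟨ε, hε, hball⟩ := Metric.isOpen_iff.1 hU x hx
  obtain ⟨ε₁, hε₁0, hε₁, hnorm⟩ := exists_pos_norm_indicatorConstLp_lt (μ := μ) (p := p)
    (zero_lt_one.trans_le Fact.out).ne' hp hε Real.pi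
  obtain ⟨δ, hδ, M, hM, E, hE, hE0, hEb⟩ := exists_measurableSet_pos_le_abs (μ := μ)
    (Lp.stronglyMeasurable G) ha.stronglyMeasurable_mk
    fun h => hne ((Lp.eq_zero_iff_ae_eq_zero).2 h)
  obtain ⟨D₀, hD₀E, hD₀, hD₀0, hD₀ε⟩ := hμ.exists_pos_subset_le hE hE0 hε₁0
  -- With `|a| ≤ M` on `D`, this makes each integral over a subset of `D` at most `δ / 4`; `M + 1`
  -- avoids division by zero.
  obtain ⟨ε₂, hε₂0, hε₂⟩ := exists_pos_setIntegral_abs_le (hb D₀ (hD₀ε.trans_lt hε₁))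
    (η := δ / (4 * (M + 1))) (by positivity)
  obtain ⟨D, hDD₀, hD, hD0, hDε⟩ := hμ.exists_pos_subset_le hD₀ hD₀0 hε₂0
  have hDε₁ : μ D ≤ ε₁ := (measure_mono hDD₀).trans hD₀ε
  have hDfin : μ D < ∞ := hDε₁.trans_lt hε₁
  have hbD : ∫ s in D, |b s| ∂μ ≤ δ / (4 * (M + 1)) := by
    have := hε₂ D hD hDε
    rwa [inter_eq_self_of_subset_right hDD₀] at this
  have hfin : ∀ A ⊆ D, μ A ≠ ∞ := fun A hA => ((measure_mono hA).trans_lt hDfin).ne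
  have hsmall : ∀ A ⊆ D, ∀ᵐ t ∂μ, t ∈ D →
      |∫ s in A, k (t, s) * Real.sin (x t - x s) ∂μ| ≤ δ / 4 := by
    intro A hA
    filter_upwards [ae_slice_bound hk hab, ha.ae_eq_mk] with t ⟨_, ht⟩ hat htD
    have ht' : ∀ᵐ s ∂μ, |k (t, s) * Real.sin (x t - x s)| ≤ |a t| * |b s| := by
      filter_upwards [ht] with s hs
      rw [abs_mul]
      exact (mul_le_of_le_one_right (abs_nonneg _) (Real.abs_sin_le_one _)).trans hs
    have haM : |a t| ≤ M := by
      rw [hat]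
      exact (hEb t (hD₀E (hDD₀ htD))).2
    have hbA : ∫ s in A, |b s| ∂μ ≤ δ / (4 * (M + 1)) :=
      (setIntegral_mono_set (hb D hDfin).abs (ae_of_all _ fun s => abs_nonneg (b s))
        (ae_of_all _ hA)).trans hbD
    calc _ ≤ |a t| * ∫ s in A, |b s| ∂μ :=
          abs_setIntegral_le_of_abs_le ht' (hb A (hfin A hA).lt_top)
      _ ≤ (M + 1) * (δ / (4 * (M + 1))) := by
          gcongr
          linarith
      _ = δ / 4 := by field_simp
  obtain ⟨A, hA, hAsep⟩ := hμ.exists_seq_subset_symmDiff hD hDfin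
  let y : ℕ → Lp ℝ p μ := fun n => x + indicatorConstLp p (hA n).2 (hfin _ (hA n).1) Real.pi
  have hy : ∀ n, y n ∈ Metric.ball x ε := by
    intro n
    rw [mem_ball_iff_norm, add_sub_cancel_left]
    exact hnorm _ _ _ _ (abs_of_pos Real.pi_pos).le ((measure_mono (hA n).1).trans hDε₁)
  have hc : 0 < δ * (μ.real D / 3) ^ (1 / q.toReal) := by
    have : 0 < μ.real D := ENNReal.toReal_pos hD0.ne' hDfin.ne
    positivity
  refine not_isCompact_closure_of_pairwise_le_dist (u := fun n => kuramotoOperator hF (y n))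
    (fun n => mem_image_of_mem _ (mem_range_self n)) hc ?_ (hcomp (range y)
      (range_subset_iff.2 fun n => hball (hy n))
      (Metric.isBounded_ball.subset (range_subset_iff.2 hy)))
  intro m n hmn
  have hS : MeasurableSet (D ∩ symmDiff (A m) (A n)) := hD.inter ((hA m).2.symmDiff (hA n).2)
  have hSfin : μ (D ∩ symmDiff (A m) (A n)) ≠ ∞ := hfin _ inter_subset_left
  rw [dist_eq_norm]
  calc δ * (μ.real D / 3) ^ (1 / q.toReal)
      ≤ ‖δ‖ * μ.real (D ∩ symmDiff (A m) (A n)) ^ (1 / q.toReal) := by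
        rw [Real.norm_of_nonneg hδ.le]
        gcongr
        exact hAsep hmn
    _ = ‖indicatorConstLp q hS hSfin δ‖ :=
        (norm_indicatorConstLp (zero_lt_one.trans_le Fact.out).ne' hq).symm
    _ ≤ _ := by
      refine Lp.norm_le_norm_of_ae_le ?_
      filter_upwards [indicatorConstLp_coeFn (p := q) (hs := hS) (hμs := hSfin) (c := δ),
        Lp.coeFn_sub (kuramotoOperator hF (y m)) (kuramotoOperator hF (y n)),
        hF.ae_add_pi_indicator x (hA m).2 (hfin _ (hA m).1),
        hF.ae_add_pi_indicator x (hA n).2 (hfin _ (hA n).1),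
        hsmall _ (hA m).1, hsmall _ (hA n).1] with t h1 h2 hm hn hsm hsn
      rw [h1, h2, Pi.sub_apply]
      by_cases ht : t ∈ D ∩ symmDiff (A m) (A n)
      · rw [indicator_of_mem ht, hm, hn, ← hG, Real.norm_of_nonneg hδ.le, Real.norm_eq_abs]
        have hGt := (hEb t (hD₀E (hDD₀ ht.1))).1
        have him := hsm ht.1
        have hin := hsn ht.1
        generalize ∫ s in A m, k (t, s) * Real.sin (x t - x s) ∂μ = I at him ⊢
        generalize ∫ s in A n, k (t, s) * Real.sin (x t - x s) ∂μ = J at hin ⊢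
        rw [abs_le] at him hin
        -- Exactly one image has its sign flipped, so the difference is `±(2 * G t - 2 * I - 2 *
        -- J)`, of modulus at least `2 * δ - δ = δ`.
        rcases ht.2 with ⟨h, h'⟩ | ⟨h, h'⟩ <;>
          simp only [h, h', indicator_of_mem, indicator_of_notMem, not_false_eq_true,
            Pi.one_apply] <;>
          rcases le_abs.1 hGt with hg | hg <;> rw [le_abs] <;> grind
      · rw [indicator_of_notMem ht, norm_zero]
        exact norm_nonneg _

end Noncompactness

theorem mainTheorem7 {Ω : Type*} [MeasurableSpace Ω] (μ : Measure Ω) [SigmaFinite μ]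
    (hμ : NoFiniteAtoms μ)
    (p q : ℝ≥0∞) [Fact (1 ≤ p)] [Fact (1 ≤ q)] (hp : 1 < p) (hpq : p ≤ q) (hq : q < ∞)
    (k : Ω × Ω → ℝ) (hk : AEStronglyMeasurable k (μ.prod μ))
    (a b : Ω → ℝ) (ha : MemLp a q μ) (hb : MemLp b (p / (p - 1)) μ)
    (hab : ∀ᵐ z ∂(μ.prod μ), |k z| ≤ a z.1 * b z.2) :
    (Integrable b μ → KuramotoActs μ k p q) ∧
      (¬ (k =ᵐ[μ.prod μ] 0) →
        ∀ (hF : KuramotoActs μ k p q) (U : Set (Lp ℝ p μ)), IsOpen U → U.Nonempty →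
          ¬ IsCompactMapOn (kuramotoOperator hF) U) := by
  have hab' : ∀ᵐ z ∂(μ.prod μ), |k z| ≤ |a z.1| * |b z.2| := by
    filter_upwards [hab] with z hz
    rw [← abs_mul]
    exact hz.trans (le_abs_self _)
  refine ⟨fun hbi => kuramotoActs_of_integrable hk ha hbi hab', fun hk0 hF U hU hne => ?_⟩
  have hptop : p ≠ ∞ := (hpq.trans_lt hq).ne
  have hp' : 1 ≤ p / (p - 1) := by
    rw [ENNReal.le_div_iff_mul_le (Or.inl (tsub_pos_of_lt hp).ne')
      (Or.inl (ENNReal.sub_ne_top hptop)), one_mul]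
    exact tsub_le_self
  have hbS : ∀ S, μ S < ∞ → IntegrableOn b S μ := fun S hS =>
    hb.integrableOn_of_measure_lt_top hp' hS
  have haS : ∀ S, μ S < ∞ → IntegrableOn a S μ := fun S hS =>
    ha.integrableOn_of_measure_lt_top Fact.out hS
  obtain ⟨x, hx, hx0⟩ := hF.exists_operator_ne_zero hμ hptop hk haS hbS hab' hk0 hU hne
  exact hF.not_isCompactMapOn hμ hptop hq.ne hk ha.1 hbS hab' hU hx hx0
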